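/- Let $\mathbb F=\mathbb R$ or $\mathbb C$, and let $\mathrm{Sym}_n=\mathrm{Sym}_n(\mathbb F)$ be the real vector space of self-adjoint $n\times n$ matrices over $\mathbb F$ (real symmetric, respectively complex Hermitian). Let $M$ be a $C^\infty$ manifold of dimension $d$ (without boundary, not necessarily compact), let $\mathcal F\colon M\to \mathrm{Sym}_n$ be a $C^\infty$ map, let $1\le k\le n$, and let $\lambda_k(y)$ be the $k$-th eigenvalue of $\mathcal F(y)$, where eigenvalues are repeated according to multiplicity and numbered in increasing order. Fix $x\in M$, let $\mathbf E_k\subset\mathbb F^n$ be the eigenspace of $\mathcal F(x)$ for the eigenvalue $\lambda_k(x)$, let $\nu=\dim_{\mathbb F}\mathbf E_k\ge 1$ be its multiplicity, and let $\mathcal U\colon \mathbb F^\nu\to\mathbb F^n$ be any linear isometry with range $\mathbf E_k$. Define the linear operator $$\mathcal H_x\colon T_xM\to \mathrm{Sym}_\nu,\qquad \mathcal H_x v=\mathcal U^*\big(d\mathcal F(x)v\big)\,\mathcal U .$$ Let $\mathrm{Sym}_\nu^{+}\subset\mathrm{Sym}_\nu$ be the set of positive semidefinite matrices, and let $S^\perp$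 denote the orthogonal complement of a subspace $S$ in $\mathrm{Sym}_\nu$ with respect to the Frobenius inner product $\langle X,Y\rangle=\operatorname{Tr}(XY)$. For a function $\phi\colon M\to\mathbb R$, a neighborhood $U$ of $x$ and $\epsilon>0$ put $U_x^{\pm\epsilon}(\phi)=\{y\in U:\phi(y)\le\phi(x)\pm\epsilon\}$. The point $x$ is called topologically regular for $\phi$ if there are arbitrarily small open neighborhoods $U$ of $x$, homeomorphic to a $d$-dimensional open ball, such that for all sufficiently small $\epsilon>0$ (depending on $U$) the set $U_x^{-\epsilon}(\phi)$ is a strong deformation retract of $U_x^{+\epsilon}(\phi)$. Then: 1. $\operatorname{Ran}\mathcal H_x$ contains a positive definite matrix if and only if $(\operatorname{Ran}\mathcal H_x)^\perp\cap \mathrm{Sym}_\nu^+=\{0\}$. 2. If these equivalent conditions hold, then $x$ is topologically regular for $\lambda_k$. -/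

import Mathlib

open scoped Manifold ContDiff Topology Matrix ComplexOrder

noncomputable section

/-- The real vector space `Sym_n(𝕜)` of self-adjoint `n × n` matrices (real symmetric for `𝕜 = ℝ`,
complex Hermitian for `𝕜 = ℂ`). -/
def SymMat (𝕜 : Type*) [RCLike 𝕜] (n : ℕ) : Type _ :=
  selfAdjoint.submodule ℝ (Matrix (Fin n) (Fin n) 𝕜)

section Norm

open scoped Matrix.Norms.Frobenius

/-- `Sym_n` is normed by the Frobenius norm. -/
instance (𝕜 : Type*) [RCLike 𝕜] (n : ℕ) : NormedAddCommGroup (SymMat 𝕜 n) :=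
  inferInstanceAs (NormedAddCommGroup (selfAdjoint.submodule ℝ (Matrix (Fin n) (Fin n) 𝕜)))

instance (𝕜 : Type*) [RCLike 𝕜] (n : ℕ) : NormedSpace ℝ (SymMat 𝕜 n) :=
  inferInstanceAs (NormedSpace ℝ (selfAdjoint.submodule ℝ (Matrix (Fin n) (Fin n) 𝕜)))

end Norm

namespace SymMat

variable {𝕜 : Type*} [RCLike 𝕜] {n ν : ℕ}

/-- The inclusion of `Sym_n` into the space of all `n × n` matrices. -/
def toMat : SymMat 𝕜 n →ₗ[ℝ] Matrix (Fin n) (Fin n) 𝕜 :=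
  (selfAdjoint.submodule ℝ (Matrix (Fin n) (Fin n) 𝕜)).subtype

theorem isHermitian (A : SymMat 𝕜 n) : (toMat A).IsHermitian :=
  A.2

theorem toMat_injective : Function.Injective (toMat : SymMat 𝕜 n → Matrix (Fin n) (Fin n) 𝕜) :=
  Subtype.val_injective

/-- The eigenvalues of `A`, repeated according to multiplicity and numbered in increasing order.
(Mathlib's `eigenvalues₀` is in decreasing order, hence `Fin.rev`.) -/
def eigval (A : SymMat 𝕜 n) (k : Fin n) : ℝ :=
  A.isHermitian.eigenvalues₀ (Fin.cast (Fintype.card_fin n).symm k.rev)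

/-- The eigenspace of `A` for its `k`-th eigenvalue. -/
def eigspace (A : SymMat 𝕜 n) (k : Fin n) : Submodule 𝕜 (EuclideanSpace 𝕜 (Fin n)) :=
  Module.End.eigenspace (Matrix.toEuclideanLin (toMat A))
    (A.eigval k : 𝕜)

/-- The compression `X ↦ U* X U`, as a real-linear map `Sym_n → Sym_ν`. -/
def compression (U : Matrix (Fin n) (Fin ν) 𝕜) : SymMat 𝕜 n →ₗ[ℝ] SymMat 𝕜 ν where
  toFun X := ⟨Uᴴ * (toMat X) * U,
    Matrix.isHermitian_conjTranspose_mul_mul U X.isHermitian⟩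
  map_add' X Y := by
    apply toMat_injective
    change Uᴴ * toMat (X + Y) * U = Uᴴ * toMat X * U + Uᴴ * toMat Y * U
    rw [map_add, Matrix.mul_add, Matrix.add_mul]
  map_smul' c X := by
    apply toMat_injective
    change Uᴴ * toMat (c • X) * U = c • (Uᴴ * toMat X * U)
    rw [map_smul, Matrix.mul_smul, Matrix.smul_mul]

/-- The Frobenius inner product `⟨X, Y⟩ = Tr (X Y)` on `Sym_ν` (the trace is a real number). -/
def frobInner (X Y : SymMat 𝕜 ν) : ℝ :=
  RCLike.re (Matrix.trace ((toMat X) * (toMat Y)))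

/-- The orthogonal complement in `Sym_ν` with respect to the Frobenius inner product. -/
def perp (S : Submodule ℝ (SymMat 𝕜 ν)) : Set (SymMat 𝕜 ν) :=
  {Y | ∀ X ∈ S, frobInner X Y = 0}

variable (𝕜 ν) in
/-- The cone of positive semidefinite matrices. -/
def psdCone : Set (SymMat 𝕜 ν) :=
  {Y | (toMat Y).PosSemidef}

end SymMat

/-- `U` is (the matrix of) a linear isometry `𝕜^ν → 𝕜^n` with range the subspace `E`, i.e. its
columns form an orthonormal basis of `E`. -/
def IsIsometryOnto {𝕜 : Type*} [RCLike 𝕜] {n ν : ℕ} (U : Matrix (Fin n) (Fin ν) 𝕜)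
    (E : Submodule 𝕜 (EuclideanSpace 𝕜 (Fin n))) : Prop :=
  Uᴴ * U = 1 ∧ LinearMap.range (Matrix.toEuclideanLin U) = E

/-- The operator `v ↦ U* (dF(x) v) U` from `T_x M` to `Sym_ν`. -/
def compressedDeriv {𝕜 : Type*} [RCLike 𝕜] {n ν : ℕ} (d : ℕ) {M : Type*} [TopologicalSpace M]
    [ChartedSpace (EuclideanSpace ℝ (Fin d)) M] (F : M → SymMat 𝕜 n) (x : M)
    (U : Matrix (Fin n) (Fin ν) 𝕜) : TangentSpace (𝓡 d) x →ₗ[ℝ] SymMat 𝕜 ν :=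
  SymMat.compression U ∘ₗ (mvfderiv (𝓡 d) F x).toLinearMap

/-- `A` is a strong deformation retract of `B`, for subsets `A`, `B` of a topological space: the
identity of `B` is homotopic in `B`, relative to `A`, to a map with values in `A`. -/
def IsStrongDeformationRetract {X : Type*} [TopologicalSpace X] (A B : Set X) : Prop :=
  A ⊆ B ∧ ∃ r : C(B, B), (∀ y, (r y : X) ∈ A) ∧
    Nonempty (ContinuousMap.HomotopyRel (ContinuousMap.id B) r {y : B | (y : X) ∈ A})

/-- The local sublevel set `{y ∈ U | φ y ≤ φ x + s}`; it is used with `s = ε` and `s = -ε`. -/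
def localSublevel {X : Type*} (φ : X → ℝ) (x : X) (U : Set X) (s : ℝ) : Set X :=
  {y | y ∈ U ∧ φ y ≤ φ x + s}

/-- `x` is a topologically regular point of `φ`, on a `d`-dimensional manifold: there are
arbitrarily small neighbourhoods `U` of `x`, homeomorphic to a ball, such that for all sufficiently
small `ε > 0` the sublevel set of `φ|U` at `φ x - ε` is a strong deformation retract of the one at
`φ x + ε`. -/
def IsTopologicallyRegular (d : ℕ) {M : Type*} [TopologicalSpace M] (φ : M → ℝ) (x : M) : Prop :=
  ∀ W ∈ 𝓝 x, ∃ U ⊆ W, IsOpen U ∧ x ∈ U ∧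
    Nonempty (U ≃ₜ Metric.ball (0 : EuclideanSpace ℝ (Fin d)) 1) ∧
    ∃ ε₀ : ℝ, 0 < ε₀ ∧ ∀ ε : ℝ, 0 < ε → ε ≤ ε₀ →
      IsStrongDeformationRetract (localSublevel φ x U (-ε)) (localSublevel φ x U ε)

end

/-! The first equivalence is a theorem of the alternative: if a subspace misses the open convex cone
of positive definite matrices, a separating functional is, by Riesz representation, the Frobenius
product with a matrix orthogonal to the subspace, which is positive semidefinite because the
semidefinite cone is self-dual.

For the regularity, let `B = dF(x) w` be positive on the eigenspace. Given a self-adjoint matrix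
`A'` near `F x`, a matrix `B'` near `B` and a small `t > 0`, dimension counting yields a unit vector
`u`, common to a spectral subspace of `A'` and one of `A' + t B'`, on which the quadratic forms
compare `λ_k (A')` with `λ_k (A' + t B')`; were `λ_k` not to increase, `u` would be close to the
eigenspace of `F x`, where `B` is positive. By strict differentiability `λ_k ∘ F` is therefore
strictly increasing along all short segments parallel to `w` near `x`. In a thin cylinder with axis
`w`, sliding the points down along `-w` until they reach the level `λ_k (x) - ε` is the required
deformation. -/

noncomputable section

section Topology

namespace IsStrongDeformationRetract

variable {X Y : Type*} [TopologicalSpace X] [TopologicalSpace Y] {A B : Set X}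

theorem of_homotopy (hAB : A ⊆ B) (H : unitInterval × B → X) (hH : Continuous H)
    (hB : ∀ p, H p ∈ B) (h0 : ∀ y, H (0, y) = y) (h1 : ∀ y, H (1, y) ∈ A)
    (hA : ∀ t (y : B), (y : X) ∈ A → H (t, y) = y) : IsStrongDeformationRetract A B :=
  ⟨hAB, ⟨fun y => ⟨H (1, y), hB _⟩, by fun_prop⟩, h1, ⟨⟨⟨⟨fun p => ⟨H p, hB p⟩, by fun_prop⟩,
    fun y => Subtype.ext (h0 y), fun _ => rfl⟩, fun t y hy => Subtype.ext (hA t y hy)⟩⟩⟩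

theorem image (h : IsStrongDeformationRetract A B) (e : OpenPartialHomeomorph X Y)
    (hB : B ⊆ e.source) : IsStrongDeformationRetract (e '' A) (e '' B) := by
  obtain ⟨hAB, r, hr, ⟨G⟩⟩ := h
  let b : B ≃ₜ e '' B := e.homeomorphOfImageSubsetSource hB rfl
  have hb (y : e '' B) : e (b.symm y) = y := congrArg Subtype.val (b.apply_symm_apply y)
  refine of_homotopy (Set.image_mono hAB) (fun p => b (G (p.1, b.symm p.2))) (by fun_prop)
    (fun p => (b _).2) (fun y => ?_) (fun y => ?_) fun t y hy => ?_
  · simp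
  · rw [G.apply_one]
    exact Set.mem_image_of_mem e (hr _)
  · have hyA : ((b.symm y : B) : X) ∈ A := by
      obtain ⟨a, ha, hay⟩ := hy
      rwa [← e.injOn (hB (hAB ha)) (hB (b.symm y).2) (hay.trans (hb y).symm)]
    have hG : G (t, b.symm y) = b.symm y := G.eq_fst t hyA
    rw [hG, b.apply_symm_apply]

end IsStrongDeformationRetract

theorem localSublevel_image {X Y : Type*} [TopologicalSpace X] [TopologicalSpace Y] (f : Y → X)
    (φ : X → ℝ) (y : Y) (U : Set Y) (s : ℝ) :
    localSublevel φ (f y) (f '' U) s = f '' localSublevel (φ ∘ f) y U s :=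
  (Set.image_inter_preimage f U {z | φ z ≤ φ (f y) + s}).symm

theorem IsTopologicallyRegular.of_openPartialHomeomorph {d : ℕ} {X Y : Type*} [TopologicalSpace X]
    [TopologicalSpace Y] {φ : X → ℝ} {x : X} (e : OpenPartialHomeomorph X Y) (hx : x ∈ e.source)
    (h : IsTopologicallyRegular d (φ ∘ e.symm) (e x)) : IsTopologicallyRegular d φ x := by
  intro W hW
  have hex : e x ∈ e.target := e.map_source hx
  have hW' : e.symm ⁻¹' W ∈ 𝓝 (e x) :=
    (e.symm.continuousAt hex).preimage_mem_nhds (by rwa [e.left_inv hx])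
  obtain ⟨U, hUW, hUo, hxU, ⟨u⟩, ε₀, hε₀, hε⟩ :=
    h (e.target ∩ e.symm ⁻¹' W) (Filter.inter_mem (e.open_target.mem_nhds hex) hW')
  have hUt : U ⊆ e.symm.source := fun y hy => (hUW hy).1
  refine ⟨e.symm '' U, Set.image_subset_iff.2 fun y hy => (hUW hy).2,
    e.symm.isOpen_image_of_subset_source hUo hUt, ⟨e x, hxU, e.left_inv hx⟩,
    ⟨(e.symm.homeomorphOfImageSubsetSource hUt rfl).symm.trans u⟩, ε₀, hε₀, fun ε hε0 hεε₀ => ?_⟩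
  have hlevel (s : ℝ) : localSublevel φ x (e.symm '' U) s =
      e.symm '' localSublevel (φ ∘ e.symm) (e x) U s := by
    rw [← localSublevel_image, e.left_inv hx]
  rw [hlevel, hlevel]
  exact (hε ε hε0 hεε₀).image e.symm fun y hy => hUt hy.1

theorem nonempty_homeomorph_ball_of_convex {E : Type*} [NormedAddCommGroup E] [NormedSpace ℝ E]
    {U : Set E} (hc : Convex ℝ U) (ho : IsOpen U) (hne : U.Nonempty) (hb : Bornology.IsBounded U) :
    Nonempty (U ≃ₜ Metric.ball (0 : E) 1) := by
  obtain ⟨h, hU, -⟩ := exists_homeomorph_image_interior_closure_frontier_eq_unitBall hc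
    (by rwa [ho.interior_eq]) hb
  rw [ho.interior_eq] at hU
  exact ⟨(h.image U).trans (Homeomorph.setCongr hU)⟩

end Topology

/-- `ψ` is strictly increasing in the direction `w` on the part in `U` of each line parallel
to `w`. These parts need not be connected. -/
def StrictMonoOnLines {E : Type*} [AddCommGroup E] [Module ℝ E] (ψ : E → ℝ) (w : E) (U : Set E) :
    Prop :=
  ∀ y, StrictMonoOn (fun s : ℝ => ψ (y + s • w)) {s | y + s • w ∈ U}

namespace StrictMonoOnLines

section TopologicalVectorSpace

variable {E : Type*} [AddCommGroup E] [Module ℝ E] {ψ : E → ℝ} {w : E} {U V : Set E}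

theorem mono (h : StrictMonoOnLines ψ w V) (hUV : U ⊆ V) : StrictMonoOnLines ψ w U :=
  fun y => (h y).mono fun _ hs => hUV hs

variable [TopologicalSpace E] [IsTopologicalAddGroup E] [ContinuousSMul ℝ E]

theorem continuousOn_levelTime (h : StrictMonoOnLines ψ w U) (hU : IsOpen U)
    (hψ : ContinuousOn ψ U) {α : ℝ} {τ : E → ℝ} (hτU : ∀ y ∈ U, y + τ y • w ∈ U)
    (hτ : ∀ y ∈ U, ψ (y + τ y • w) = α) : ContinuousOn τ U := by
  intro y hy
  have hline : Continuous fun s : ℝ => y + s • w := by fun_prop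
  have hnear : ∀ᶠ s in 𝓝 (τ y), y + s • w ∈ U := (hU.preimage hline).mem_nhds (hτU y hy)
  have hshift (s : ℝ) : ContinuousAt (fun z => z + s • w) y := by fun_prop
  have hmem {s : ℝ} (hs : y + s • w ∈ U) : ∀ᶠ z in 𝓝 y, z + s • w ∈ U :=
    (hshift s).preimage_mem_nhds (hU.mem_nhds hs)
  have hval {s : ℝ} (hs : y + s • w ∈ U) : ContinuousAt (fun z => ψ (z + s • w)) y :=
    ContinuousAt.comp (f := fun z => z + s • w) (hψ.continuousAt (hU.mem_nhds hs)) (hshift s)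
  refine tendsto_order.2 ⟨fun b hb => ?_, fun b hb => ?_⟩
  · obtain ⟨s, hsU, hbs, hs⟩ := ((hnear.filter_mono nhdsWithin_le_nhds).and
      (Ioo_mem_nhdsLT hb)).exists
    have hlt : ψ (y + s • w) < α := hτ y hy ▸ h y hsU (hτU y hy) hs
    filter_upwards [self_mem_nhdsWithin, (hmem hsU).filter_mono nhdsWithin_le_nhds,
      ((hval hsU).eventually_lt_const hlt).filter_mono nhdsWithin_le_nhds] with z hz hzU hzs
    rw [← hτ z hz] at hzs
    exact hbs.trans (((h z).lt_iff_lt hzU (hτU z hz)).1 hzs)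
  · obtain ⟨s, hsU, hs, hsb⟩ := ((hnear.filter_mono nhdsWithin_le_nhds).and
      (Ioo_mem_nhdsGT hb)).exists
    have hlt : α < ψ (y + s • w) := hτ y hy ▸ h y (hτU y hy) hsU hs
    filter_upwards [self_mem_nhdsWithin, (hmem hsU).filter_mono nhdsWithin_le_nhds,
      ((hval hsU).eventually_const_lt hlt).filter_mono nhdsWithin_le_nhds] with z hz hzU hzs
    rw [← hτ z hz] at hzs
    exact (((h z).lt_iff_lt (hτU z hz) hzU).1 hzs).trans hsb

/-- The points above the level `α` move down along `-w` until they reach it. -/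
theorem isStrongDeformationRetract_sublevel (h : StrictMonoOnLines ψ w U) (hU : IsOpen U)
    (hUc : Convex ℝ U) (hψ : ContinuousOn ψ U) {α β : ℝ} (hαβ : α ≤ β)
    (hα : ∀ y ∈ U, ∃ s : ℝ, y + s • w ∈ U ∧ ψ (y + s • w) = α) :
    IsStrongDeformationRetract {y | y ∈ U ∧ ψ y ≤ α} {y | y ∈ U ∧ ψ y ≤ β} := by
  choose! τ hτU hτ using hα
  have hτc : ContinuousOn τ U := h.continuousOn_levelTime hU hψ hτU hτ
  have hle {y : E} {s t : ℝ} (hs : y + s • w ∈ U) (ht : y + t • w ∈ U) :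
      ψ (y + s • w) ≤ ψ (y + t • w) ↔ s ≤ t := (h y).le_iff_le hs ht
  have hzero {y : E} (hy : y ∈ U) : y + (0 : ℝ) • w ∈ U := by rwa [zero_smul, add_zero]
  have hlevel {y : E} (hy : y ∈ U) : ψ y ≤ α ↔ 0 ≤ τ y := by
    rw [← hle (hzero hy) (hτU y hy), hτ y hy, zero_smul, add_zero]
  have hmin {y : E} (hy : y ∈ U) : y + min 0 (τ y) • w ∈ U := by
    rcases min_choice 0 (τ y) with hm | hm <;> rw [hm]
    exacts [hzero hy, hτU y hy]
  have hseg (t : unitInterval) {y : E} (hy : y ∈ U) : y + (t * min 0 (τ y)) • w ∈ U := by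
    rw [mul_smul]
    exact hUc.add_smul_mem hy (hmin hy) t.2
  refine .of_homotopy (fun y hy => ⟨hy.1, hy.2.trans hαβ⟩)
    (fun p => (p.2 : E) + (p.1 * min 0 (τ p.2)) • w) ?_ (fun p => ⟨hseg p.1 p.2.2.1, ?_⟩)
    (fun y => by simp) (fun y => ⟨hseg 1 y.2.1, ?_⟩) fun t y hy => ?_
  · have : Continuous fun p : unitInterval × {y | y ∈ U ∧ ψ y ≤ β} => τ p.2 :=
      hτc.comp_continuous (by fun_prop) fun p => p.2.2.1
    exact (continuous_subtype_val.comp continuous_snd).add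
      (((continuous_subtype_val.comp continuous_fst).mul (continuous_const.min this)).smul
        continuous_const)
  · have hdown : (p.1 : ℝ) * min 0 (τ p.2) ≤ 0 :=
      mul_nonpos_of_nonneg_of_nonpos p.1.2.1 (min_le_left _ _)
    rw [← hle (hseg p.1 p.2.2.1) (hzero p.2.2.1), zero_smul, add_zero] at hdown
    exact hdown.trans p.2.2.2
  · rw [← hτ y y.2.1]
    refine (hle (hseg 1 y.2.1) (hτU y y.2.1)).2 ?_
    rw [Set.Icc.coe_one, one_mul]
    exact min_le_right _ _
  · rw [min_eq_left ((hlevel y.2.1).1 hy.2), mul_zero, zero_smul, add_zero]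

end TopologicalVectorSpace

section Normed

variable {E : Type*} [NormedAddCommGroup E] [NormedSpace ℝ E] {ψ : E → ℝ} {w a : E}

theorem exists_mem_nhds_of_eventually_lt
    (h : ∀ᶠ p : E × ℝ in 𝓝 a ×ˢ 𝓝[>] 0, ψ p.1 < ψ (p.1 + p.2 • w)) :
    ∃ N ∈ 𝓝 a, StrictMonoOnLines ψ w N := by
  obtain ⟨P, hP, Q, hQ, hPQ⟩ := Filter.eventually_prod_iff.1 h
  obtain ⟨t₀, ht₀, hQt⟩ := mem_nhdsGT_iff_exists_Ioo_subset.1 hQ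
  rw [Set.mem_Ioi] at ht₀
  have hw : w ≠ 0 := by
    rintro rfl
    obtain ⟨p, hp⟩ := h.exists
    simp at hp
  have hr : 0 < t₀ * ‖w‖ / 2 := by positivity
  refine ⟨{y | P y} ∩ Metric.ball a (t₀ * ‖w‖ / 2),
    Filter.inter_mem hP (Metric.ball_mem_nhds a hr), fun y s hs t ht hst => ?_⟩
  have hshort : t - s < t₀ := by
    have hdist : dist (y + t • w) (y + s • w) = (t - s) * ‖w‖ := by
      rw [dist_add_left, dist_eq_norm, ← sub_smul, norm_smul, Real.norm_of_nonneg (by linarith)]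
    have hlt := dist_triangle_right (y + t • w) (y + s • w) a
    rw [hdist] at hlt
    refine lt_of_mul_lt_mul_right ?_ (norm_nonneg w)
    linarith [Metric.mem_ball.1 hs.2, Metric.mem_ball.1 ht.2]
  have hlt := hPQ hs.1 (hQt ⟨sub_pos.2 hst, hshort⟩)
  rwa [add_assoc, ← add_smul, add_sub_cancel] at hlt

theorem exists_ball_forall_ends_separated {N : Set E} (h : StrictMonoOnLines ψ w N)
    (hN : N ∈ 𝓝 a) (hψ : ContinuousOn ψ N) :
    ∃ r > 0, ∃ δ : ℝ, 0 < δ ∧ ∃ ε₀ > 0, ∀ z ∈ Metric.ball a r,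
      (∀ s ∈ Set.Icc (-δ) δ, z + s • w ∈ interior N) ∧
        ψ (z + (-δ) • w) < ψ a - ε₀ ∧ ψ a + ε₀ < ψ (z + δ • w) := by
  have hline : ContinuousAt (fun p : E × ℝ => p.1 + p.2 • w) (a, 0) := by fun_prop
  obtain ⟨ρ, hρ, hρN⟩ := Metric.mem_nhds_iff.1 (hline.preimage_mem_nhds
    (interior_mem_nhds.2 (by rwa [zero_smul, add_zero])))
  obtain ⟨δ, hδ, hδρ⟩ := exists_between hρ
  have hmem {z : E} (hz : z ∈ Metric.ball a ρ) {s : ℝ} (hs : s ∈ Set.Icc (-δ) δ) :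
      z + s • w ∈ interior N := by
    have hzs : (z, s) ∈ Metric.ball ((a, 0) : E × ℝ) ρ := by
      rw [← ball_prod_same]
      exact ⟨hz, by simpa using (abs_le.2 hs).trans_lt hδρ⟩
    exact hρN hzs
  have hneg : -δ ∈ Set.Icc (-δ) δ := Set.left_mem_Icc.2 (by linarith)
  have hpos : δ ∈ Set.Icc (-δ) δ := Set.right_mem_Icc.2 (by linarith)
  have hmono := (h a).mono fun s hs =>
    interior_subset (s := N) (hmem (Metric.mem_ball_self hρ) hs)
  have hzero : (0 : ℝ) ∈ Set.Icc (-δ) δ := ⟨by linarith, hδ.le⟩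
  have hlow : ψ (a + (-δ) • w) < ψ a := by simpa using hmono hneg hzero (by linarith)
  have hhigh : ψ a < ψ (a + δ • w) := by simpa using hmono hzero hpos hδ
  obtain ⟨ε₀, hε₀, hlt⟩ := exists_between (lt_min (sub_pos.2 hlow) (sub_pos.2 hhigh))
  obtain ⟨hlt₁, hlt₂⟩ := lt_min_iff.1 hlt
  have hcont {s : ℝ} (hs : s ∈ Set.Icc (-δ) δ) : ContinuousAt (fun z => ψ (z + s • w)) a :=
    ContinuousAt.comp (f := fun z => z + s • w) (hψ.continuousAt
      (mem_interior_iff_mem_nhds.1 (hmem (Metric.mem_ball_self hρ) hs))) (by fun_prop)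
  obtain ⟨r, hr, hball⟩ := Metric.mem_nhds_iff.1 (Filter.inter_mem (Metric.ball_mem_nhds a hρ)
    (((hcont hneg).eventually_lt_const (show _ < ψ a - ε₀ by linarith)).and
      ((hcont hpos).eventually_const_lt (show ψ a + ε₀ < _ by linarith))))
  exact ⟨r, hr, δ, hδ, ε₀, hε₀, fun z hz => ⟨fun s hs => hmem (hball hz).1 hs, (hball hz).2⟩⟩

open scoped Pointwise in
/-- The neighbourhood is a cylinder with axis `w` that is thin compared with its length, so that
the values of `ψ` on its two ends are separated from `ψ a`. -/
theorem exists_convex_nhd_forall_line_meets_levels {N : Set E} (h : StrictMonoOnLines ψ w N)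
    (hN : N ∈ 𝓝 a) (hψ : ContinuousOn ψ N) :
    ∃ U ⊆ N, IsOpen U ∧ Convex ℝ U ∧ a ∈ U ∧ ∃ ε₀ > 0, ∀ α, |α - ψ a| ≤ ε₀ →
      ∀ y ∈ U, ∃ s : ℝ, y + s • w ∈ U ∧ ψ (y + s • w) = α := by
  obtain ⟨r, hr, δ, hδ, ε₀, hε₀, hball⟩ := h.exists_ball_forall_ends_separated hN hψ
  refine ⟨Metric.ball a r + (fun s : ℝ => s • w) '' Set.Ioo (-δ) δ, ?_,
    Metric.isOpen_ball.add_right, (convex_ball a r).add ((convex_Ioo (-δ) δ).is_linear_image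
      (IsLinearMap.isLinearMap_smul' w)), ?_, ε₀, hε₀, fun α hα y hy => ?_⟩
  · rintro _ ⟨z, hz, _, ⟨s, hs, rfl⟩, rfl⟩
    exact interior_subset ((hball z hz).1 s (Set.Ioo_subset_Icc_self hs))
  · exact ⟨a, Metric.mem_ball_self hr, 0, ⟨0, ⟨neg_lt_zero.2 hδ, hδ⟩, zero_smul ℝ w⟩, add_zero a⟩
  · obtain ⟨z, hz, _, ⟨s, -, rfl⟩, rfl⟩ := hy
    obtain ⟨hmem, hlow, hhigh⟩ := hball z hz
    obtain ⟨hα₁, hα₂⟩ := abs_le.1 hα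
    have hline : ContinuousOn (fun t : ℝ => ψ (z + t • w)) (Set.Icc (-δ) δ) :=
      hψ.comp (by fun_prop) fun t ht => interior_subset (hmem t ht)
    obtain ⟨t, ht, hψt⟩ := intermediate_value_Ioo (by linarith) hline
      (show α ∈ Set.Ioo _ _ from ⟨by linarith, by linarith⟩)
    have hzt : z + s • w + (t - s) • w = z + t • w := by rw [sub_smul]; abel
    refine ⟨t - s, ?_, ?_⟩ <;> simp only [hzt]
    exacts [⟨z, hz, _, ⟨t, ht, rfl⟩, rfl⟩, hψt]

end Normed

end StrictMonoOnLines

theorem isTopologicallyRegular_of_eventually_lt {d : ℕ} {ψ : EuclideanSpace ℝ (Fin d) → ℝ}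
    {w a : EuclideanSpace ℝ (Fin d)} (hψ : ∀ᶠ y in 𝓝 a, ContinuousAt ψ y)
    (h : ∀ᶠ p : EuclideanSpace ℝ (Fin d) × ℝ in 𝓝 a ×ˢ 𝓝[>] 0, ψ p.1 < ψ (p.1 + p.2 • w)) :
    IsTopologicallyRegular d ψ a := by
  intro W hW
  obtain ⟨N, hN, hmono⟩ := StrictMonoOnLines.exists_mem_nhds_of_eventually_lt h
  let V := N ∩ W ∩ Metric.ball a 1 ∩ {y | ContinuousAt ψ y}
  have hV : V ∈ 𝓝 a := Filter.inter_mem (Filter.inter_mem (Filter.inter_mem hN hW)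
    (Metric.ball_mem_nhds a one_pos)) hψ
  have hmonoV : StrictMonoOnLines ψ w V := hmono.mono fun y hy => hy.1.1.1
  have hψV : ContinuousOn ψ V := fun y hy => hy.2.continuousWithinAt
  obtain ⟨U, hUV, hUo, hUc, haU, ε₀, hε₀, hlevel⟩ :=
    hmonoV.exists_convex_nhd_forall_line_meets_levels hV hψV
  refine ⟨U, fun y hy => (hUV hy).1.1.2, hUo, haU, nonempty_homeomorph_ball_of_convex hUc hUo
    ⟨a, haU⟩ (Metric.isBounded_ball.subset fun y hy => (hUV hy).1.2), ε₀, hε₀,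
    fun ε hε hεε₀ => ?_⟩
  refine (hmonoV.mono hUV).isStrongDeformationRetract_sublevel hUo hUc (hψV.mono hUV)
    (by linarith) (hlevel _ ?_)
  rwa [add_sub_cancel_left, abs_neg, abs_of_pos hε]

section SpectralTheory

namespace SymMat

variable {𝕜 : Type*} [RCLike 𝕜] {n : ℕ}

instance : FiniteDimensional ℝ (SymMat 𝕜 n) :=
  inferInstanceAs (FiniteDimensional ℝ (selfAdjoint.submodule ℝ (Matrix (Fin n) (Fin n) 𝕜)))

/-- The operator on Euclidean space defined by a self-adjoint matrix. -/
def toCLM : SymMat 𝕜 n →ₗ[ℝ] (EuclideanSpace 𝕜 (Fin n) →L[𝕜] EuclideanSpace 𝕜 (Fin n)) where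
  toFun A := Matrix.toEuclideanCLM (𝕜 := 𝕜) (toMat A)
  map_add' A B := by rw [map_add, map_add]
  map_smul' c A := by
    ext u i
    simp [Matrix.smul_mulVec]

theorem continuous_toCLM : Continuous (toCLM : SymMat 𝕜 n → _) :=
  LinearMap.continuous_of_finiteDimensional (𝕜 := ℝ) (toCLM (𝕜 := 𝕜) (n := n))

theorem mem_eigspace {A : SymMat 𝕜 n} {k : Fin n} {u : EuclideanSpace 𝕜 (Fin n)} :
    u ∈ A.eigspace k ↔ toCLM A u = (A.eigval k : 𝕜) • u :=
  Module.End.mem_eigenspace_iff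

theorem eigval_mono (A : SymMat 𝕜 n) : Monotone A.eigval := fun _ _ hij =>
  A.isHermitian.eigenvalues₀_antitone (Fin.rev_le_rev.2 hij)

theorem isSymmetric_toEuclideanLin (A : SymMat 𝕜 n) :
    (Matrix.toEuclideanLin (toMat A)).IsSymmetric :=
  Matrix.isSymmetric_toEuclideanLin_iff.2 A.isHermitian

/-- An orthonormal basis of eigenvectors, numbered like the eigenvalues `eigval`. -/
def eigenbasis (A : SymMat 𝕜 n) : OrthonormalBasis (Fin n) 𝕜 (EuclideanSpace 𝕜 (Fin n)) :=
  (A.isSymmetric_toEuclideanLin.eigenvectorBasis finrank_euclideanSpace).reindex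
    ((finCongr (Fintype.card_fin n)).trans Fin.revPerm)

theorem toCLM_eigenbasis (A : SymMat 𝕜 n) (i : Fin n) :
    toCLM A (A.eigenbasis i) = (A.eigval i : 𝕜) • A.eigenbasis i := by
  rw [eigenbasis, OrthonormalBasis.reindex_apply]
  exact A.isSymmetric_toEuclideanLin.apply_eigenvectorBasis finrank_euclideanSpace _

theorem inner_eigenbasis_toCLM (A : SymMat 𝕜 n) (i : Fin n) (u : EuclideanSpace 𝕜 (Fin n)) :
    inner 𝕜 (A.eigenbasis i) (toCLM A u) = A.eigval i * inner 𝕜 (A.eigenbasis i) u := by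
  have hsymm : inner 𝕜 (toCLM A (A.eigenbasis i)) u = inner 𝕜 (A.eigenbasis i) (toCLM A u) :=
    A.isSymmetric_toEuclideanLin _ _
  rw [← hsymm, toCLM_eigenbasis, inner_smul_left, RCLike.conj_ofReal]

theorem abs_eigval_le (A : SymMat 𝕜 n) (i : Fin n) : |A.eigval i| ≤ ‖toCLM A‖ := by
  simpa [toCLM_eigenbasis, norm_smul] using (toCLM A).le_opNorm (A.eigenbasis i)

/-- The value at `u` of the quadratic form of a self-adjoint matrix `A`, as a linear function
of `A`. -/
def quadForm (u : EuclideanSpace 𝕜 (Fin n)) : SymMat 𝕜 n →ₗ[ℝ] ℝ where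
  toFun A := RCLike.re (inner 𝕜 u (toCLM A u))
  map_add' A B := by rw [map_add, add_apply, inner_add_right, map_add]
  map_smul' c A := by
    rw [map_smul, smul_apply, RCLike.real_smul_eq_coe_smul (K := 𝕜), inner_smul_right,
      RCLike.re_ofReal_mul]
    rfl

theorem quadForm_apply (u : EuclideanSpace 𝕜 (Fin n)) (A : SymMat 𝕜 n) :
    quadForm u A = RCLike.re (inner 𝕜 u (toCLM A u)) := rfl

theorem abs_quadForm_le (u : EuclideanSpace 𝕜 (Fin n)) (A : SymMat 𝕜 n) :
    |quadForm u A| ≤ ‖toCLM A‖ * ‖u‖ ^ 2 :=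
  calc |quadForm u A| ≤ ‖u‖ * ‖toCLM A u‖ :=
        (RCLike.abs_re_le_norm _).trans (norm_inner_le_norm _ _)
    _ ≤ ‖u‖ * (‖toCLM A‖ * ‖u‖) := by gcongr; exact (toCLM A).le_opNorm u
    _ = ‖toCLM A‖ * ‖u‖ ^ 2 := by ring

theorem quadForm_sub_mul_norm_sq (A : SymMat 𝕜 n) (c : ℝ) (u : EuclideanSpace 𝕜 (Fin n)) :
    quadForm u A - c * ‖u‖ ^ 2 =
      ∑ i, (A.eigval i - c) * ‖inner 𝕜 (A.eigenbasis i) u‖ ^ 2 := by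
  rw [quadForm_apply, ← A.eigenbasis.sum_inner_mul_inner u (toCLM A u),
    ← A.eigenbasis.sum_sq_norm_inner_right u, map_sum, Finset.mul_sum, ← Finset.sum_sub_distrib]
  refine Finset.sum_congr rfl fun i _ => ?_
  rw [inner_eigenbasis_toCLM, mul_left_comm, ← inner_conj_symm u, RCLike.conj_mul,
    RCLike.re_ofReal_mul, ← RCLike.ofReal_pow, RCLike.ofReal_re, sub_mul]

theorem norm_toCLM_sub_smul_sq (A : SymMat 𝕜 n) (c : ℝ) (u : EuclideanSpace 𝕜 (Fin n)) :
    ‖toCLM A u - (c : 𝕜) • u‖ ^ 2 =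
      ∑ i, (A.eigval i - c) ^ 2 * ‖inner 𝕜 (A.eigenbasis i) u‖ ^ 2 := by
  rw [← A.eigenbasis.sum_sq_norm_inner_right]
  refine Finset.sum_congr rfl fun i _ => ?_
  rw [inner_sub_right, inner_eigenbasis_toCLM, inner_smul_right, ← sub_mul, norm_mul, mul_pow,
    ← RCLike.ofReal_sub, RCLike.norm_ofReal, sq_abs]

section

variable {A : SymMat 𝕜 n} {k : Fin n} {u : EuclideanSpace 𝕜 (Fin n)}

theorem quadForm_le_eigval_mul_norm_sq (hu : ∀ i, k < i → inner 𝕜 (A.eigenbasis i) u = 0) :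
    quadForm u A ≤ A.eigval k * ‖u‖ ^ 2 := by
  rw [← sub_nonpos, quadForm_sub_mul_norm_sq]
  refine Finset.sum_nonpos fun i _ => ?_
  rcases lt_or_ge k i with hki | hik
  · simp [hu i hki]
  · exact mul_nonpos_of_nonpos_of_nonneg (sub_nonpos.2 (A.eigval_mono hik)) (sq_nonneg _)

theorem eigval_mul_norm_sq_le_quadForm (hu : ∀ i < k, inner 𝕜 (A.eigenbasis i) u = 0) :
    A.eigval k * ‖u‖ ^ 2 ≤ quadForm u A := by
  rw [← sub_nonneg, quadForm_sub_mul_norm_sq]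
  refine Finset.sum_nonneg fun i _ => ?_
  rcases lt_or_ge i k with hik | hki
  · simp [hu i hik]
  · exact mul_nonneg (sub_nonneg.2 (A.eigval_mono hki)) (sq_nonneg _)

theorem norm_toCLM_sub_eigval_smul_sq_le (hu : ∀ i < k, inner 𝕜 (A.eigenbasis i) u = 0) :
    ‖toCLM A u - (A.eigval k : 𝕜) • u‖ ^ 2 ≤
      2 * ‖toCLM A‖ * (quadForm u A - A.eigval k * ‖u‖ ^ 2) := by
  rw [quadForm_sub_mul_norm_sq, norm_toCLM_sub_smul_sq, Finset.mul_sum]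
  refine Finset.sum_le_sum fun i _ => ?_
  rcases lt_or_ge i k with hik | hki
  · simp [hu i hik]
  · rw [sq (A.eigval i - _), ← mul_assoc]
    have hnonneg : 0 ≤ A.eigval i - A.eigval k := sub_nonneg.2 (A.eigval_mono hki)
    gcongr
    linarith [(abs_le.1 (A.abs_eigval_le i)).2, (abs_le.1 (A.abs_eigval_le k)).1]

end

/-- The two families of orthogonality conditions are `n - 1` linear equations. -/
theorem exists_norm_eq_one_of_orthonormalBasis
    (e e' : OrthonormalBasis (Fin n) 𝕜 (EuclideanSpace 𝕜 (Fin n))) (k : Fin n) :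
    ∃ u : EuclideanSpace 𝕜 (Fin n), ‖u‖ = 1 ∧
      (∀ i < k, inner 𝕜 (e i) u = 0) ∧ ∀ i, k < i → inner 𝕜 (e' i) u = 0 := by
  let f : EuclideanSpace 𝕜 (Fin n) →ₗ[𝕜] ({i // i ≠ k} → 𝕜) :=
    LinearMap.pi fun i => innerₛₗ 𝕜 (if i < k then e i else e' i)
  have hf : LinearMap.ker f ≠ ⊥ := by
    refine LinearMap.ker_ne_bot_of_finrank_lt ?_
    have := k.pos
    simp only [Module.finrank_fintype_fun_eq_card, finrank_euclideanSpace,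
      Fintype.card_subtype_compl, Fintype.card_unique, Fintype.card_fin]
    omega
  obtain ⟨u, hu, hu0⟩ := (Submodule.ne_bot_iff _).1 hf
  have horth (i : Fin n) (hi : i ≠ k) : inner 𝕜 (if i < k then e i else e' i) u = 0 :=
    congrFun (LinearMap.mem_ker.1 hu) ⟨i, hi⟩
  refine ⟨(‖u‖⁻¹ : 𝕜) • u, norm_smul_inv_norm hu0, fun i hi => ?_, fun i hi => ?_⟩
  · rw [inner_smul_right, show inner 𝕜 (e i) u = 0 by simpa [hi] using horth i hi.ne, mul_zero]
  · rw [inner_smul_right, show inner 𝕜 (e' i) u = 0 by simpa [hi.not_gt] using horth i hi.ne',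
      mul_zero]

theorem exists_norm_eq_one_quadForm (A B : SymMat 𝕜 n) (k : Fin n) :
    ∃ u : EuclideanSpace 𝕜 (Fin n), ‖u‖ = 1 ∧ A.eigval k ≤ quadForm u A ∧
      ‖toCLM A u - (A.eigval k : 𝕜) • u‖ ^ 2 ≤ 2 * ‖toCLM A‖ * (quadForm u A - A.eigval k) ∧
      quadForm u B ≤ B.eigval k := by
  obtain ⟨u, hu, hlow, hhigh⟩ :=
    exists_norm_eq_one_of_orthonormalBasis A.eigenbasis B.eigenbasis k
  refine ⟨u, hu, ?_, ?_, ?_⟩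
  · simpa [hu] using eigval_mul_norm_sq_le_quadForm hlow
  · simpa [hu] using norm_toCLM_sub_eigval_smul_sq_le hlow
  · simpa [hu] using quadForm_le_eigval_mul_norm_sq hhigh

theorem eigval_le_eigval_add_norm (A B : SymMat 𝕜 n) (k : Fin n) :
    A.eigval k ≤ B.eigval k + ‖toCLM (A - B)‖ := by
  obtain ⟨u, hu, hA, -, hB⟩ := exists_norm_eq_one_quadForm A B k
  have hAB : |quadForm u A - quadForm u B| ≤ ‖toCLM (A - B)‖ := by
    simpa [hu] using abs_quadForm_le u (A - B)
  linarith [(abs_le.1 hAB).2]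

theorem continuous_eigval (k : Fin n) : Continuous fun A : SymMat 𝕜 n => A.eigval k := by
  refine continuous_iff_continuousAt.2 fun A => ?_
  refine tendsto_iff_dist_tendsto_zero.2 (squeeze_zero (g := fun B => ‖toCLM (B - A)‖)
    (fun _ => dist_nonneg) (fun B => ?_) ?_)
  · have hAB := eigval_le_eigval_add_norm A B k
    rw [← neg_sub, map_neg, norm_neg] at hAB
    rw [Real.dist_eq, abs_le]
    constructor <;> linarith [eigval_le_eigval_add_norm B A k]
  · have hcont : Continuous fun B : SymMat 𝕜 n => ‖toCLM (B - A)‖ :=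
      (continuous_toCLM.comp (continuous_sub_right A)).norm
    simpa using hcont.tendsto A

/-- If the eigenvalue did not increase, the unit vector common to the upper spectral subspace
of `A` and the lower one of `A + t • B` would violate the hypothesis. -/
theorem eigval_lt_eigval_add_smul {A B : SymMat 𝕜 n} {k : Fin n} {t : ℝ} (ht : 0 < t)
    (h : ∀ u : EuclideanSpace 𝕜 (Fin n), ‖u‖ = 1 → 0 < quadForm u B ∨
      2 * ‖toCLM A‖ * (t * ‖toCLM B‖) < ‖toCLM A u - (A.eigval k : 𝕜) • u‖ ^ 2) :
    A.eigval k < (A + t • B).eigval k := by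
  by_contra! hle
  obtain ⟨u, hu, hlow, hnorm, hhigh⟩ := exists_norm_eq_one_quadForm A (A + t • B) k
  rw [map_add, map_smul, smul_eq_mul] at hhigh
  have hB : -(t * quadForm u B) ≤ t * ‖toCLM B‖ := by
    have := (abs_le.1 (abs_quadForm_le u B)).1
    rw [hu, one_pow, mul_one] at this
    nlinarith
  rcases h u hu with hpos | hbig
  · linarith [mul_pos ht hpos]
  · refine hbig.not_ge (hnorm.trans ?_)
    gcongr
    linarith

/-- If `u` is not an eigenvector of `A` at `x₀`, then it has a nonzero image under `A - λ`. -/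
theorem eventually_quadForm_pos_or_lt_norm_sq {X : Type*} [TopologicalSpace X]
    {A B : X → SymMat 𝕜 n} {u : X → EuclideanSpace 𝕜 (Fin n)} {t : X → ℝ} {x₀ : X} (k : Fin n)
    (hA : ContinuousAt A x₀) (hB : ContinuousAt B x₀) (hu : ContinuousAt u x₀)
    (ht : ContinuousAt t x₀) (ht₀ : t x₀ = 0)
    (hpos : u x₀ ∈ (A x₀).eigspace k → 0 < quadForm (u x₀) (B x₀)) :
    ∀ᶠ x in 𝓝 x₀, 0 < quadForm (u x) (B x) ∨ 2 * ‖toCLM (A x)‖ * (t x * ‖toCLM (B x)‖) <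
      ‖toCLM (A x) (u x) - ((A x).eigval k : 𝕜) • u x‖ ^ 2 := by
  have hcA : ContinuousAt (fun x => toCLM (A x)) x₀ :=
    continuous_toCLM.continuousAt.comp (f := A) hA
  have hcB : ContinuousAt (fun x => toCLM (B x)) x₀ :=
    continuous_toCLM.continuousAt.comp (f := B) hB
  have heigval : ContinuousAt (fun x => ((A x).eigval k : 𝕜)) x₀ :=
    RCLike.continuous_ofReal.continuousAt.comp
      ((continuous_eigval k).continuousAt.comp (f := A) hA)
  by_cases hmem : u x₀ ∈ (A x₀).eigspace k
  · have hquad : ContinuousAt (fun x => quadForm (u x) (B x)) x₀ :=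
      RCLike.continuous_re.continuousAt.comp (hu.inner (hcB.clm_apply hu))
    exact (hquad.eventually_const_lt (hpos hmem)).mono fun _ => .inl
  · rw [mem_eigspace, ← sub_eq_zero] at hmem
    refine (((hcA.norm.const_mul 2).mul (ht.mul hcB.norm)).eventually_lt
      (((hcA.clm_apply hu).sub (heigval.smul hu)).norm.pow 2) ?_).mono fun _ => .inr
    simpa [ht₀] using pow_pos (norm_pos_iff.2 hmem) 2

theorem eventually_eigval_lt_eigval_add_smul {A₀ B₀ : SymMat 𝕜 n} {k : Fin n}
    (hB : ∀ u ∈ A₀.eigspace k, u ≠ 0 → 0 < quadForm u B₀) :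
    ∀ᶠ p : (SymMat 𝕜 n × SymMat 𝕜 n) × ℝ in 𝓝 (A₀, B₀) ×ˢ 𝓝[>] 0,
      p.1.1.eigval k < (p.1.1 + p.2 • p.1.2).eigval k := by
  have hsphere : ∀ᶠ p : (SymMat 𝕜 n × SymMat 𝕜 n) × ℝ in 𝓝 ((A₀, B₀), 0),
      ∀ u ∈ Metric.sphere (0 : EuclideanSpace 𝕜 (Fin n)) 1, 0 < quadForm u p.1.2 ∨
        2 * ‖toCLM p.1.1‖ * (p.2 * ‖toCLM p.1.2‖) <
          ‖toCLM p.1.1 u - (p.1.1.eigval k : 𝕜) • u‖ ^ 2 := by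
    refine (isCompact_sphere _ _).eventually_forall_of_forall_eventually fun u hu => ?_
    have hu0 : u ≠ 0 := ne_zero_of_mem_unit_sphere ⟨u, hu⟩
    refine eventually_quadForm_pos_or_lt_norm_sq k
      (X := ((SymMat 𝕜 n × SymMat 𝕜 n) × ℝ) × EuclideanSpace 𝕜 (Fin n)) (A := fun q => q.1.1.1)
      (B := fun q => q.1.1.2) (u := fun q => q.2) (t := fun q => q.1.2) ?_ ?_ ?_ ?_ rfl (hB u · hu0)
    all_goals fun_prop
  rw [nhds_prod_eq] at hsphere
  filter_upwards [hsphere.filter_mono (Filter.prod_mono_right _ nhdsWithin_le_nhds),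
    Filter.tendsto_snd.eventually self_mem_nhdsWithin] with p hp ht
  exact eigval_lt_eigval_add_smul ht fun u hu => hp u (mem_sphere_zero_iff_norm.2 hu)

end SymMat

end SpectralTheory

section Alternative

theorem exists_clm_eq_zero_and_pos_of_disjoint {E : Type*} [AddCommGroup E] [Module ℝ E]
    [TopologicalSpace E] [IsTopologicalAddGroup E] [ContinuousSMul ℝ E] {C : Set E}
    {S : Submodule ℝ E} (hconvex : Convex ℝ C) (hopen : IsOpen C) (hdisj : Disjoint C S) :
    ∃ f : E →L[ℝ] ℝ, (∀ x ∈ S, f x = 0) ∧ ∀ x ∈ C, 0 < f x := by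
  obtain ⟨f, c, hfC, hfS⟩ := geometric_hahn_banach_open hconvex hopen S.convex hdisj
  have hc : c ≤ 0 := by simpa using hfS 0 S.zero_mem
  refine ⟨-f, fun x hx => neg_eq_zero.2 (of_not_not fun hfx : f x ≠ 0 => ?_),
    fun x hx => neg_pos.2 ((hfC x hx).trans_le hc)⟩
  have hle := hfS (((c - 1) / f x) • x) (S.smul_mem _ hx)
  rw [map_smul, smul_eq_mul, div_mul_cancel₀ _ hfx] at hle
  linarith

namespace SymMat

variable {𝕜 : Type*} [RCLike 𝕜] {n : ℕ}

instance : One (SymMat 𝕜 n) :=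
  ⟨⟨1, Matrix.isHermitian_one⟩⟩

theorem posDef_one : (toMat (1 : SymMat 𝕜 n)).PosDef :=
  Matrix.PosDef.one

theorem quadForm_eq_re_dotProduct (u : EuclideanSpace 𝕜 (Fin n)) (A : SymMat 𝕜 n) :
    quadForm u A = RCLike.re (star u.ofLp ⬝ᵥ (toMat A *ᵥ u.ofLp)) := by
  rw [quadForm_apply, EuclideanSpace.inner_eq_star_dotProduct, dotProduct_comm]
  rfl

theorem quadForm_eigenbasis (A : SymMat 𝕜 n) (i : Fin n) :
    quadForm (A.eigenbasis i) A = A.eigval i := by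
  rw [quadForm_apply, toCLM_eigenbasis, inner_smul_right, RCLike.re_ofReal_mul]
  simp

theorem posSemidef_iff_quadForm_nonneg {A : SymMat 𝕜 n} :
    (toMat A).PosSemidef ↔ ∀ u, 0 ≤ quadForm u A := by
  rw [← Matrix.isPositive_toEuclideanLin_iff]
  refine (and_iff_right A.isSymmetric_toEuclideanLin).trans (forall_congr' fun u => ?_)
  rw [← inner_conj_symm, RCLike.conj_re, quadForm_apply]
  rfl

theorem posDef_iff_eigval_pos {A : SymMat 𝕜 n} : (toMat A).PosDef ↔ ∀ i, 0 < A.eigval i := by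
  rw [A.isHermitian.posDef_iff_eigenvalues_pos]
  exact ((Fintype.equivOfCardEq _).symm.forall_congr_right
      (q := fun j => 0 < A.isHermitian.eigenvalues₀ j)).trans
    ((Fin.revPerm.trans (finCongr (Fintype.card_fin n).symm)).forall_congr_right
      (q := fun j => 0 < A.isHermitian.eigenvalues₀ j)).symm

theorem isOpen_setOf_posDef : IsOpen {A : SymMat 𝕜 n | (toMat A).PosDef} := by
  simp only [posDef_iff_eigval_pos, Set.ofPred_forall]
  exact isOpen_iInter_of_finite fun i => isOpen_lt continuous_const (continuous_eigval i)

theorem convex_setOf_posDef : Convex ℝ {A : SymMat 𝕜 n | (toMat A).PosDef} :=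
  convex_iff_forall_pos.2 fun A hA B hB a b ha hb _ => by
    rw [Set.mem_ofPred_eq, map_add, map_smul, map_smul]
    exact (hA.smul ha).add (hB.smul hb)

theorem quadForm_pos {A : SymMat 𝕜 n} (hA : (toMat A).PosDef) {u : EuclideanSpace 𝕜 (Fin n)}
    (hu : u ≠ 0) : 0 < quadForm u A := by
  rw [quadForm_eq_re_dotProduct]
  exact hA.re_dotProduct_pos ((WithLp.ofLp_eq_zero 2).not.2 hu)

theorem eq_zero_of_forall_eigval_eq_zero {A : SymMat 𝕜 n} (h : ∀ i, A.eigval i = 0) : A = 0 := by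
  have hCLM : toCLM A = 0 := ContinuousLinearMap.coe_injective <|
    A.eigenbasis.toBasis.ext fun i => by simp [toCLM_eigenbasis, h]
  exact toMat_injective (by simpa [toCLM] using hCLM)

variable (𝕜 n) in
/-- The Frobenius inner product as a real bilinear form. -/
def frobForm : LinearMap.BilinForm ℝ (SymMat 𝕜 n) :=
  LinearMap.mk₂ ℝ frobInner
    (fun _ _ _ => by simp [frobInner, Matrix.add_mul])
    (fun _ _ _ => by simp [frobInner, RCLike.smul_re])
    (fun _ _ _ => by simp [frobInner, Matrix.mul_add])
    (fun _ _ _ => by simp [frobInner, RCLike.smul_re])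

theorem frobForm_apply (X Y : SymMat 𝕜 n) : frobForm 𝕜 n X Y = frobInner X Y := rfl

theorem frobInner_comm (X Y : SymMat 𝕜 n) : frobInner X Y = frobInner Y X := by
  rw [frobInner, Matrix.trace_mul_comm, frobInner]

theorem frobInner_eq_sum (X Y : SymMat 𝕜 n) :
    frobInner X Y = ∑ i, Y.eigval i * quadForm (Y.eigenbasis i) X := by
  have htrace : Matrix.trace (toMat X * toMat Y) =
      LinearMap.trace 𝕜 _ (toCLM X ∘L toCLM Y).toLinearMap := by
    rw [← Matrix.trace_toLin_eq _ (PiLp.basisFun 2 𝕜 (Fin n)), ← Matrix.toLpLin_eq_toLin,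
      Matrix.toLpLin_mul_same]
    rfl
  rw [frobInner, htrace, LinearMap.trace_eq_sum_inner _ Y.eigenbasis, map_sum]
  refine Finset.sum_congr rfl fun i _ => ?_
  rw [ContinuousLinearMap.coe_coe, ContinuousLinearMap.comp_apply, toCLM_eigenbasis, map_smul,
    inner_smul_right, RCLike.re_ofReal_mul, quadForm_apply]

theorem frobForm_nondegenerate : (frobForm 𝕜 n).Nondegenerate := by
  have hsymm : (frobForm 𝕜 n).IsSymm := ⟨fun X Y => frobInner_comm X Y⟩
  have hself (X : SymMat 𝕜 n) : frobForm 𝕜 n X X = ∑ i, X.eigval i ^ 2 := by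
    simp only [frobForm_apply, frobInner_eq_sum, quadForm_eigenbasis, sq]
  refine hsymm.isRefl.nondegenerate_iff_separatingLeft.2 fun X hX =>
    eq_zero_of_forall_eigval_eq_zero fun i => ?_
  have hsum := (hself X).symm.trans (hX X)
  rw [Finset.sum_eq_zero_iff_of_nonneg fun i _ => sq_nonneg _] at hsum
  exact pow_eq_zero_iff two_ne_zero |>.1 (hsum i (Finset.mem_univ i))

theorem eq_zero_of_frobInner_eq_zero {C Y : SymMat 𝕜 n} (hC : (toMat C).PosDef)
    (hY : (toMat Y).PosSemidef) (h : frobInner C Y = 0) : Y = 0 := by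
  have hpos (i : Fin n) : 0 < quadForm (Y.eigenbasis i) C :=
    quadForm_pos hC (Y.eigenbasis.orthonormal.ne_zero i)
  have hnonneg (i : Fin n) : 0 ≤ Y.eigval i :=
    quadForm_eigenbasis Y i ▸ posSemidef_iff_quadForm_nonneg.1 hY _
  rw [frobInner_eq_sum, Finset.sum_eq_zero_iff_of_nonneg
    fun i _ => mul_nonneg (hnonneg i) (hpos i).le] at h
  exact eq_zero_of_forall_eigval_eq_zero fun i =>
    (mul_eq_zero.1 (h i (Finset.mem_univ i))).resolve_right (hpos i).ne'

/-- The rank-one matrix `u u*`. -/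
def rankOne (u : EuclideanSpace 𝕜 (Fin n)) : SymMat 𝕜 n :=
  ⟨Matrix.vecMulVec u.ofLp (star u.ofLp), (Matrix.posSemidef_vecMulVec_self_star _).isHermitian⟩

theorem posSemidef_rankOne (u : EuclideanSpace 𝕜 (Fin n)) : (toMat (rankOne u)).PosSemidef :=
  Matrix.posSemidef_vecMulVec_self_star u.ofLp

theorem frobInner_rankOne (u : EuclideanSpace 𝕜 (Fin n)) (Y : SymMat 𝕜 n) :
    frobInner (rankOne u) Y = quadForm u Y := by
  rw [quadForm_eq_re_dotProduct, Matrix.dotProduct_mulVec, dotProduct_comm,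
    ← Matrix.trace_vecMulVec, ← Matrix.vecMulVec_mul]
  rfl

theorem posSemidef_of_forall_posDef_frobInner_pos {Y : SymMat 𝕜 n}
    (h : ∀ X : SymMat 𝕜 n, (toMat X).PosDef → 0 < frobInner X Y) : (toMat Y).PosSemidef := by
  refine posSemidef_iff_quadForm_nonneg.2 fun u => ?_
  have hperturb (ε : ℝ) (hε : 0 < ε) : 0 < quadForm u Y + ε * frobInner 1 Y := by
    have hpos : (toMat (rankOne u + ε • 1)).PosDef := by
      rw [map_add, map_smul]
      exact Matrix.PosDef.posSemidef_add (posSemidef_rankOne u) (posDef_one.smul hε)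
    have := h _ hpos
    rwa [← frobForm_apply, map_add, map_smul, LinearMap.add_apply, LinearMap.smul_apply,
      frobForm_apply, frobForm_apply, frobInner_rankOne, smul_eq_mul] at this
  refine le_of_forall_pos_le_add fun δ hδ => ?_
  have := hperturb (δ / frobInner 1 Y) (div_pos hδ (h 1 posDef_one))
  rw [div_mul_cancel₀ _ (h 1 posDef_one).ne'] at this
  exact this.le

theorem exists_posDef_iff_perp_inter_psdCone (S : Submodule ℝ (SymMat 𝕜 n)) :
    (∃ C ∈ S, (toMat C).PosDef) ↔ perp S ∩ psdCone 𝕜 n = {0} := by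
  constructor
  · rintro ⟨C, hCS, hC⟩
    refine Set.eq_singleton_iff_unique_mem.2 ⟨⟨fun X _ => ?_, ?_⟩, fun Y hY => ?_⟩
    · exact map_zero (frobForm 𝕜 n X)
    · exact Matrix.PosSemidef.zero
    · exact eq_zero_of_frobInner_eq_zero hC hY.2 (hY.1 C hCS)
  · intro h
    by_contra! hS
    obtain ⟨f, hfS, hfpos⟩ := exists_clm_eq_zero_and_pos_of_disjoint convex_setOf_posDef
      isOpen_setOf_posDef (Set.disjoint_left.2 fun C hC hCS => hS C hCS hC)
    obtain ⟨Y, hY⟩ : ∃ Y, ∀ X, frobInner X Y = f X :=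
      ⟨((frobForm 𝕜 n).toDual frobForm_nondegenerate).symm f.toLinearMap, fun X => by
        rw [frobInner_comm]
        exact (frobForm 𝕜 n).apply_toDual_symm_apply (hB := frobForm_nondegenerate) f.toLinearMap X⟩
    have hY0 : Y ∈ perp S ∩ psdCone 𝕜 n := ⟨fun X hX => (hY X).trans (hfS X hX),
      posSemidef_of_forall_posDef_frobInner_pos fun X hX => (hfpos X hX).trans_eq (hY X).symm⟩
    obtain rfl : Y = 0 := by simpa [h] using hY0
    have := hfpos 1 posDef_one
    rw [← hY, ← frobForm_apply, map_zero] at this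
    exact this.false

end SymMat

end Alternative

section EigenvalueFunction

theorem tendsto_slope_of_hasStrictFDerivAt {E V : Type*} [NormedAddCommGroup E] [NormedSpace ℝ E]
    [NormedAddCommGroup V] [NormedSpace ℝ V] {f : E → V} {f' : E →L[ℝ] V} {a : E}
    (hf : HasStrictFDerivAt f f' a) (w : E) :
    Filter.Tendsto (fun p : E × ℝ => p.2⁻¹ • (f (p.1 + p.2 • w) - f p.1)) (𝓝 a ×ˢ 𝓝[>] 0)
      (𝓝 (f' w)) := by
  have hpair : Filter.Tendsto (fun p : E × ℝ => (p.1 + p.2 • w, p.1)) (𝓝 a ×ˢ 𝓝[>] 0)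
      (𝓝 (a, a)) := by
    have hcont : Continuous fun p : E × ℝ => (p.1 + p.2 • w, p.1) := by fun_prop
    refine (hcont.tendsto' (a, 0) (a, a) (by simp)).mono_left ?_
    rw [nhds_prod_eq]
    exact Filter.prod_mono_right _ nhdsWithin_le_nhds
  have hlittle : (fun p : E × ℝ => f (p.1 + p.2 • w) - f p.1 - p.2 • f' w) =o[𝓝 a ×ˢ 𝓝[>] 0]
      fun p => p.2 := by
    refine ((hf.isLittleO.comp_tendsto hpair).congr (f₂ := fun p : E × ℝ =>
      f (p.1 + p.2 • w) - f p.1 - p.2 • f' w) (g₂ := fun p => p.2 • w) (fun p => ?_)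
      fun p => ?_).trans_isBigO (.of_bound ‖w‖ (.of_forall fun p => ?_))
    · simp
    · simp
    · rw [norm_smul, mul_comm]
  have hzero := (hlittle.tendsto_inv_smul_nhds_zero).add_const (f' w)
  rw [zero_add] at hzero
  refine hzero.congr' ?_
  filter_upwards [Filter.tendsto_snd.eventually self_mem_nhdsWithin] with p hp
  rw [smul_sub, inv_smul_smul₀ (ne_of_gt hp), sub_add_cancel]

variable {𝕜 : Type*} [RCLike 𝕜] {n ν d : ℕ}

namespace SymMat

theorem eventually_eigval_lt_of_hasStrictFDerivAt {E : Type*} [NormedAddCommGroup E]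
    [NormedSpace ℝ E] {f : E → SymMat 𝕜 n} {f' : E →L[ℝ] SymMat 𝕜 n} {a w : E} {k : Fin n}
    (hf : HasStrictFDerivAt f f' a)
    (hpos : ∀ u ∈ (f a).eigspace k, u ≠ 0 → 0 < quadForm u (f' w)) :
    ∀ᶠ p : E × ℝ in 𝓝 a ×ˢ 𝓝[>] 0, (f p.1).eigval k < (f (p.1 + p.2 • w)).eigval k := by
  have hpair : Filter.Tendsto (fun p : E × ℝ => f p.1) (𝓝 a ×ˢ 𝓝[>] 0) (𝓝 (f a)) :=
    hf.continuousAt.tendsto.comp Filter.tendsto_fst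
  filter_upwards [((hpair.prodMk_nhds (tendsto_slope_of_hasStrictFDerivAt hf w)).prodMk
    Filter.tendsto_snd).eventually (eventually_eigval_lt_eigval_add_smul hpos),
    Filter.tendsto_snd.eventually self_mem_nhdsWithin] with p hp ht
  rwa [smul_inv_smul₀ (ne_of_gt ht), add_sub_cancel] at hp

theorem quadForm_toEuclideanLin (U : Matrix (Fin n) (Fin ν) 𝕜) (a : EuclideanSpace 𝕜 (Fin ν))
    (B : SymMat 𝕜 n) : quadForm (Matrix.toEuclideanLin U a) B = quadForm a (compression U B) := by
  have hcomp : toMat (compression U B) = Uᴴ * toMat B * U := rfl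
  rw [quadForm_eq_re_dotProduct, quadForm_eq_re_dotProduct, hcomp, ← Matrix.mulVec_mulVec,
    ← Matrix.mulVec_mulVec, Matrix.dotProduct_mulVec _ Uᴴ, ← Matrix.star_mulVec]
  rfl

theorem quadForm_pos_of_posDef_compression {U : Matrix (Fin n) (Fin ν) 𝕜} {B : SymMat 𝕜 n}
    (hB : (toMat (compression U B)).PosDef) {u : EuclideanSpace 𝕜 (Fin n)}
    (hu : u ∈ LinearMap.range (Matrix.toEuclideanLin U)) (hu0 : u ≠ 0) : 0 < quadForm u B := by
  obtain ⟨a, rfl⟩ := hu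
  rw [quadForm_toEuclideanLin]
  exact quadForm_pos hB fun ha => hu0 (by rw [ha, map_zero])

end SymMat

theorem isTopologicallyRegular_eigval_of_hasStrictFDerivAt
    {f : EuclideanSpace ℝ (Fin d) → SymMat 𝕜 n} {f' : EuclideanSpace ℝ (Fin d) →L[ℝ] SymMat 𝕜 n}
    {a w : EuclideanSpace ℝ (Fin d)} {k : Fin n} (hf : HasStrictFDerivAt f f' a)
    (hpos : ∀ u ∈ (f a).eigspace k, u ≠ 0 → 0 < SymMat.quadForm u (f' w)) :
    IsTopologicallyRegular d (fun y => (f y).eigval k) a := by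
  obtain ⟨K, s, hs, hlip⟩ := hf.exists_lipschitzOnWith
  refine isTopologicallyRegular_of_eventually_lt ?_
    (SymMat.eventually_eigval_lt_of_hasStrictFDerivAt hf hpos)
  filter_upwards [eventually_mem_nhds_iff.2 hs] with y hy
  exact (SymMat.continuous_eigval k).continuousAt.comp (hlip.continuousOn.continuousAt hy)

variable {M : Type*} [TopologicalSpace M] [ChartedSpace (EuclideanSpace ℝ (Fin d)) M] {x : M}

theorem hasStrictFDerivAt_comp_chartAt_symm {V : Type*} [NormedAddCommGroup V] [NormedSpace ℝ V]
    {m : WithTop ℕ∞} (hm : m ≠ 0) {F : M → V} (hF : ContMDiffAt (𝓡 d) 𝓘(ℝ, V) m F x) :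
    HasStrictFDerivAt (F ∘ (chartAt (EuclideanSpace ℝ (Fin d)) x).symm)
      (mvfderiv (𝓡 d) F x : EuclideanSpace ℝ (Fin d) →L[ℝ] V)
      (chartAt (EuclideanSpace ℝ (Fin d)) x x) := by
  have hderiv := (hF.mdifferentiableAt hm).hasMFDerivAt.2
  have hcont := (contMDiffAt_iff.1 hF).2
  rw [ModelWithCorners.range_eq_univ] at hderiv hcont
  exact (contDiffWithinAt_univ.1 hcont).hasStrictFDerivAt' (hasFDerivWithinAt_univ.1 hderiv) hm

theorem isTopologicallyRegular_eigval {F : M → SymMat 𝕜 n}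
    (hF : ContMDiffAt (𝓡 d) 𝓘(ℝ, SymMat 𝕜 n) 1 F x) {k : Fin n} {w : TangentSpace (𝓡 d) x}
    (hw : ∀ u ∈ (F x).eigspace k, u ≠ 0 → 0 < SymMat.quadForm u (mvfderiv (𝓡 d) F x w)) :
    IsTopologicallyRegular d (fun y => (F y).eigval k) x := by
  let e := chartAt (EuclideanSpace ℝ (Fin d)) x
  have hx : x ∈ e.source := mem_chart_source _ x
  refine .of_openPartialHomeomorph e hx ?_
  refine isTopologicallyRegular_eigval_of_hasStrictFDerivAt (f := F ∘ e.symm) (w := w)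
    (hasStrictFDerivAt_comp_chartAt_symm one_ne_zero hF) ?_
  rwa [Function.comp_apply, e.left_inv hx]

end EigenvalueFunction

end

theorem mainTheorem3_general {𝕜 : Type*} [RCLike 𝕜] {d n ν : ℕ} {M : Type*} [TopologicalSpace M]
    [ChartedSpace (EuclideanSpace ℝ (Fin d)) M] (F : M → SymMat 𝕜 n) (k : Fin n) (x : M)
    (hF : ContMDiffAt (𝓡 d) 𝓘(ℝ, SymMat 𝕜 n) 1 F x)
    (U : Matrix (Fin n) (Fin ν) 𝕜) (hU : IsIsometryOnto U ((F x).eigspace k)) :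
    ((∃ C ∈ LinearMap.range (compressedDeriv d F x U), (SymMat.toMat C).PosDef) ↔
      SymMat.perp (LinearMap.range (compressedDeriv d F x U)) ∩ SymMat.psdCone 𝕜 ν = {0}) ∧
    ((∃ C ∈ LinearMap.range (compressedDeriv d F x U), (SymMat.toMat C).PosDef) →
      IsTopologicallyRegular d (fun y => (F y).eigval k) x) := by
  refine ⟨SymMat.exists_posDef_iff_perp_inter_psdCone _, ?_⟩
  rintro ⟨_, ⟨w, rfl⟩, hw⟩
  exact isTopologicallyRegular_eigval hF fun u hu =>
    SymMat.quadForm_pos_of_posDef_compression hw (hU.2.symm ▸ hu)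

theorem mainTheorem3 {𝕜 : Type*} [RCLike 𝕜] {d n ν : ℕ}
    {M : Type*} [TopologicalSpace M] [ChartedSpace (EuclideanSpace ℝ (Fin d)) M]
    [IsManifold (𝓡 d) ∞ M]
    (F : M → SymMat 𝕜 n) (hF : ContMDiff (𝓡 d) 𝓘(ℝ, SymMat 𝕜 n) ∞ F)
    (k : Fin n) (x : M)
    (hν : Module.finrank 𝕜 ((F x).eigspace k) = ν) (hν1 : 1 ≤ ν)
    (U : Matrix (Fin n) (Fin ν) 𝕜) (hU : IsIsometryOnto U ((F x).eigspace k)) :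
    ((∃ C ∈ LinearMap.range (compressedDeriv d F x U), (SymMat.toMat C).PosDef) ↔
      SymMat.perp (LinearMap.range (compressedDeriv d F x U)) ∩ SymMat.psdCone 𝕜 ν = {0}) ∧
    ((∃ C ∈ LinearMap.range (compressedDeriv d F x U), (SymMat.toMat C).PosDef) →
      IsTopologicallyRegular d (fun y => (F y).eigval k) x) :=
  mainTheorem3_general F k x (hF.contMDiffAt.of_le (by simp)) U hU
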